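/- Let $\Lambda$ be a countable row-finite $k$-graph without sources: a countable category with a degree functor $d\colon\Lambda\to\mathbb Z_+^k$ having the unique factorization property (if $d(\lambda)=m+n$, then $\lambda=\mu\nu$ for unique $\mu,\nu$ with $d(\mu)=m$, $d(\nu)=n$), such that $0<|v\Lambda^n|<\infty$ for all vertices $v\in\Lambda^0$ and all $n\in\mathbb Z_+^k$, where $r,s$ are the codomain and domain maps and $v\Lambda^n=\{\lambda\in\Lambda: r(\lambda)=v,\ d(\lambda)=n\}$. Let $\Lambda^\infty$ be the space of infinite paths (degree preserving functors $x\colon\Omega_k\to\Lambda$, where $\Omega_k=\{(p,q)\in\mathbb Z_+^k\times\mathbb Z_+^k:p\le q\}$ with degree $q-p$), with $x(n):=x(n,n)$, with the topology generated by the sets $Z(\lambda)=\{x: x(0,d(\lambda))=\lambda\}$ and with the shifts $\sigma^n(x)(p,q)=x(n+p,n+q)$. Let $$\mathcal G_\Lambda=\{(x,m-n,y)\in\Lambda^\infty\times\mathbb Z^k\times\Lambda^\infty:\ m,n\in\mathbb Z_+^k,\ \sigma^m(x)=\sigma^n(y)\}$$ be the Deaconu--Renault groupoid, with range $x$, source $y$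 and product $(x,p,y)(y,q,w)=(x,p+q,w)$, with the topology with basis the sets $\{(x,m-n,y): x\in U,\ y\in V,\ \sigma^m(x)=\sigma^n(y)\}$ ($U,V\subset\Lambda^\infty$ open, $m,n\in\mathbb Z_+^k$), and with $\Phi(x,p,y)=p$. Its isotropy groups are abelian. Let $\mathrm{Stab}(\mathcal G_\Lambda)^{\wedge}$ be the set of pairs $(x,\chi)$ with $x\in\Lambda^\infty$ and $\chi\colon(\mathcal G_\Lambda)^x_x\to\mathbb T$ a character, with the topology whose basis consists of the finite intersections of the sets $\{(x,\chi): x\in U,\ \chi(K\cap(\mathcal G_\Lambda)^x_x)\subset W\}$, where $U\subset\Lambda^\infty$ is open, $K$ is a compact set of elements of $\mathcal G_\Lambda$ with equal range and source, and $W\subset\mathbb T$ is open. The groupoid acts on it by $g(x,\chi)=(r(g),\chi(g^{-1}\cdot g))$ for $s(g)=x$. Put $z^p=\prod_j z_j^{p_j}$ for $z\in\mathbb T^k$, $p\in\mathbb Z^k$, and let $q\colon\Lambda^\infty\times\mathbb T^k\to\mathrm{Stab}(\mathcal G_\Lambda)^{\wedge}$, $q(x,z)=(x,\ g\mapsto z^{\Phi(g)})$.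 Then there is a bijection $D\mapsto U_D$ from the set of all subsets $D\subset\Lambda^0\times\mathbb T^k$ satisfying (i) and (ii) below onto the set of all $\mathcal G_\Lambda$-invariant open subsets of $\mathrm{Stab}(\mathcal G_\Lambda)^{\wedge}$, such that for every such $D$ $$q^{-1}(U_D)=\{(x,z)\in\Lambda^\infty\times\mathbb T^k:\ (x(n),z)\in D\text{ for some }n\in\mathbb Z_+^k\}.$$ (i) For every $z\in\mathbb T^k$ the set $H=\{v\in\Lambda^0:(v,z)\in D\}$ is hereditary (if $r(\lambda)\in H$, then $s(\lambda)\in H$, for all $\lambda\in\Lambda$) and saturated (if $s(v\Lambda^n)\subset H$ for some $n\in\mathbb Z_+^k$, then $v\in H$, for all $v\in\Lambda^0$). (ii) For every $(v,z)\in D$ and every $x\in Z(v)$ there exist $\varepsilon>0$, $n\in\mathbb Z_+^k$ and a finite, possibly empty, set $\{(m(i),n(i))\}_{i=1}^N\subset\mathbb Z_+^k\times\mathbb Z_+^k$ with $\sigma^{m(i)}(x)=\sigma^{n(i)}(x)$ for all $i$, such that for each $y\in Z(x(0,n))$ there is $m\in\mathbb Z_+^k$ with $\{y(m)\}\times T_y\subset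 D$, where $$T_y=\{w\in\mathbb T^k:\ |z^{m(i)-n(i)}-w^{m(i)-n(i)}|<\varepsilon\text{ for all }i\text{ with }\sigma^{m(i)}(y)=\sigma^{n(i)}(y)\}$$ (so $T_y=\mathbb T^k$ if there is no such $i$). -/

import Mathlib

/-! # Characters of the isotropy groups of a topological groupoid

A groupoid is a category in which all morphisms are invertible. A morphism `g : x ⟶ y` has source
`s(g) = x` and range `r(g) = y`, and the product `g h` is `h ≫ g`. The objects form the unit space,
and `CategoryTheory.Arrow X` is the set of all elements of the groupoid. -/

universe u w

open CategoryTheory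

/-- The pairs `(x, χ)` of a unit `x` and a character `χ` of the isotropy group at `x`. This is the
underlying set of `Char(𝒢)`, which is denoted `Stab(𝒢)^` if the isotropy groups are abelian. -/
def IsotropyChar (X : Type u) [Groupoid.{w} X] : Type (max u w) :=
  Σ x : X, ((x ⟶ x) →* Circle)

namespace IsotropyChar

variable {X : Type u} [Groupoid.{w} X]

/-- `𝒪(U, K, W)`: the pairs `(x, χ)` with `x ∈ U` and `χ(K ∩ 𝒢ˣₓ) ⊆ W`. -/
def basicSet (U : Set X) (K : Set (Arrow X)) (W : Set Circle) : Set (IsotropyChar X) :=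
  {c | c.1 ∈ U ∧ ∀ g : c.1 ⟶ c.1, Arrow.mk g ∈ K → c.2 g ∈ W}

/-- The topology whose basis consists of the finite intersections of the sets `𝒪(U, K, W)`, with
`U` open in the unit space, `K` compact in the isotropy bundle and `W` open in the circle. -/
instance [TopologicalSpace X] [TopologicalSpace (Arrow X)] :
    TopologicalSpace (IsotropyChar X) :=
  TopologicalSpace.generateFrom
    {A | ∃ (U : Set X) (K : Set (Arrow X)) (W : Set Circle), IsOpen U ∧ IsCompact K ∧
      (∀ g ∈ K, g.left = g.right) ∧ IsOpen W ∧ A = basicSet U K W}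

/-- The action of the groupoid: `g (x, χ) = (r(g), χ(g⁻¹ · g))` if `s(g) = x`. -/
noncomputable def act {x y : X} (g : x ⟶ y) (χ : (x ⟶ x) →* Circle) : IsotropyChar X :=
  ⟨y, χ.comp (Groupoid.vertexGroupIsomOfMap g).symm.toMonoidHom⟩

/-- Invariance under the action of the groupoid. -/
def IsInvariant (A : Set (IsotropyChar X)) : Prop :=
  ∀ (x y : X) (g : x ⟶ y) (χ : (x ⟶ x) →* Circle), (⟨x, χ⟩ : IsotropyChar X) ∈ A → act g χ ∈ A

end IsotropyChar

/-! # Higher rank graphs -/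

/-- The structure of a `k`-graph on a category with set of vertices (objects) `V`: a degree functor
with the unique factorization property. A morphism `f : a ⟶ b` is a path with source `a` and
range `b`, and the composition `μ ν` of paths is `ν ≫ μ`. -/
structure KGraph (k : ℕ) (V : Type u) [Category.{w} V] where
  /-- The degree map. -/
  deg : ∀ {a b : V}, (a ⟶ b) → (Fin k → ℕ)
  deg_id : ∀ a : V, deg (𝟙 a) = 0
  deg_comp : ∀ {a b c : V} (ν : a ⟶ b) (μ : b ⟶ c), deg (ν ≫ μ) = deg μ + deg ν
  /-- If `d(f) = m + n`, then `f = μ ν` for unique `μ`, `ν` with `d(μ) = m`, `d(ν) = n`. -/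
  factorization : ∀ {a b : V} (f : a ⟶ b) (m n : Fin k → ℕ), deg f = m + n →
    ∃! p : (Σ c : V, (a ⟶ c) × (c ⟶ b)),
      p.2.1 ≫ p.2.2 = f ∧ deg p.2.2 = m ∧ deg p.2.1 = n

namespace KGraph

variable {k : ℕ} {V : Type u} [Category.{w} V] (Λ : KGraph k V)

/-- `v Λⁿ`, the set of paths of degree `n` with range `v`. -/
def pathsTo (v : V) (n : Fin k → ℕ) : Set (Arrow V) :=
  {f | f.right = v ∧ Λ.deg f.hom = n}

/-- Row-finite and without sources: `0 < |v Λⁿ| < ∞` for all `v` and `n`. -/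
def RowFiniteNoSources : Prop :=
  ∀ (v : V) (n : Fin k → ℕ), (Λ.pathsTo v n).Finite ∧ (Λ.pathsTo v n).Nonempty

/-- A set of vertices is hereditary if it contains the source of every path whose range it
contains. -/
def IsHereditary (_Λ : KGraph k V) (H : Set V) : Prop :=
  ∀ f : Arrow V, f.right ∈ H → f.left ∈ H

/-- A set `H` of vertices is saturated if `s(v Λⁿ) ⊆ H` for some `n` implies `v ∈ H`. -/
def IsSaturated (H : Set V) : Prop :=
  ∀ (v : V) (n : Fin k → ℕ), (∀ f ∈ Λ.pathsTo v n, f.left ∈ H) → v ∈ H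

/-- An infinite path: a degree preserving functor from the `k`-graph `Ω_k`. The category `Ω_k` has
the objects `p ∈ ℕᵏ` and exactly one morphism, with range `p`, source `q` and degree `q - p`,
for each pair `p ≤ q`; so it is the order dual of `ℕᵏ`, viewed as a category. -/
@[ext]
structure InfinitePath where
  /-- The functor. -/
  toFunctor : (Fin k → ℕ)ᵒᵈ ⥤ V
  deg_map : ∀ (p q : Fin k → ℕ) (h : p ≤ q),
    Λ.deg (toFunctor.map (homOfLE (OrderDual.toDual_le_toDual.2 h))) = q - p

namespace InfinitePath

variable {Λ}

/-- The vertex `x(n)`. -/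
def vertex (x : Λ.InfinitePath) (n : Fin k → ℕ) : V :=
  x.toFunctor.obj (OrderDual.toDual n)

/-- The finite path `x(p, q)`. -/
def segment (x : Λ.InfinitePath) (p q : Fin k → ℕ) (h : p ≤ q) : Arrow V :=
  Arrow.mk (x.toFunctor.map (homOfLE (OrderDual.toDual_le_toDual.2 h)))

theorem add_left_monotone (n : Fin k → ℕ) : Monotone (fun p : Fin k → ℕ => n + p) :=
  fun _ _ h => add_le_add_right h n

/-- The shift `σⁿ(x)`, with `σⁿ(x)(p, q) = x(n + p, n + q)`. -/
def shift (n : Fin k → ℕ) (x : Λ.InfinitePath) : Λ.InfinitePath where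
  toFunctor := (add_left_monotone n).dual.functor ⋙ x.toFunctor
  deg_map p q h := by
    have := x.deg_map (n + p) (n + q) (add_left_monotone n h)
    rw [add_tsub_add_eq_tsub_left] at this
    exact this

theorem shift_zero (x : Λ.InfinitePath) : shift 0 x = x := by
  apply InfinitePath.ext
  change (add_left_monotone (0 : Fin k → ℕ)).dual.functor ⋙ x.toFunctor = 𝟭 _ ⋙ x.toFunctor
  congr 1
  refine CategoryTheory.Functor.ext (fun p => ?_) (fun _ _ _ => Subsingleton.elim _ _)
  exact congrArg OrderDual.toDual (zero_add (OrderDual.ofDual p))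

theorem shift_shift (m n : Fin k → ℕ) (x : Λ.InfinitePath) :
    shift m (shift n x) = shift (m + n) x := by
  apply InfinitePath.ext
  change ((add_left_monotone m).dual.functor ⋙ (add_left_monotone n).dual.functor) ⋙ x.toFunctor =
    (add_left_monotone (m + n)).dual.functor ⋙ x.toFunctor
  congr 1
  refine CategoryTheory.Functor.ext (fun p => ?_) (fun _ _ _ => Subsingleton.elim _ _)
  refine congrArg OrderDual.toDual ?_
  change n + (m + OrderDual.ofDual p) = m + n + OrderDual.ofDual p
  rw [← add_assoc, add_comm n m]

end InfinitePath

/-- The cylinder set `Z(f)` of the infinite paths `x` with `x(0, d(f)) = f`. -/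
def cylinder (f : Arrow V) : Set Λ.InfinitePath :=
  {x | x.segment 0 (Λ.deg f.hom) (zero_le) = f}

/-- The topology on the space of infinite paths generated by the cylinder sets. -/
instance : TopologicalSpace Λ.InfinitePath :=
  TopologicalSpace.generateFrom (Set.range Λ.cylinder)

/-! ## The groupoid of a higher rank graph -/

/-- The elements `(y, l, x)` of the Deaconu-Renault groupoid with source `x` and range `y`: the
integer vectors `l = m - n` with `m, n ∈ ℕᵏ` and `σᵐ(y) = σⁿ(x)`. -/
def GroupoidHom (x y : Λ.InfinitePath) : Type :=
  {l : Fin k → ℤ // ∃ m n : Fin k → ℕ,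
    (l = fun j => (m j : ℤ) - (n j : ℤ)) ∧ y.shift m = x.shift n}

/-- The Deaconu-Renault groupoid `𝒢_Λ` of the shifts, with unit space the space of infinite paths,
`(x, 0, x)` as units and product `(z, l', y) (y, l, x) = (z, l' + l, x)`. -/
instance : Groupoid Λ.InfinitePath where
  Hom x y := Λ.GroupoidHom x y
  id x := ⟨0, 0, 0, by ext j; simp, rfl⟩
  comp {x y z} g h := ⟨h.1 + g.1, by
    obtain ⟨l, m, n, rfl, e⟩ := g
    obtain ⟨l', m', n', rfl, e'⟩ := h
    refine ⟨m + m', n + n', ?_, ?_⟩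
    · ext j; simp; ring
    · rw [← InfinitePath.shift_shift, e', InfinitePath.shift_shift, add_comm m n',
        ← InfinitePath.shift_shift, e, InfinitePath.shift_shift, add_comm n' n]⟩
  inv g := ⟨-g.1, by
    obtain ⟨l, m, n, rfl, e⟩ := g
    exact ⟨n, m, by ext j; simp, e.symm⟩⟩
  id_comp g := Subtype.ext (add_zero g.1)
  comp_id g := Subtype.ext (zero_add g.1)
  assoc f g h := Subtype.ext (add_assoc h.1 g.1 f.1).symm
  inv_comp g := Subtype.ext (add_neg_cancel g.1)
  comp_inv g := Subtype.ext (neg_add_cancel g.1)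

variable {Λ}

/-- The grading `Φ : 𝒢_Λ → ℤᵏ`, `(y, l, x) ↦ l`. -/
def grading {x y : Λ.InfinitePath} (g : x ⟶ y) : Fin k → ℤ :=
  Subtype.val (show Λ.GroupoidHom x y from g)

theorem grading_id (x : Λ.InfinitePath) : grading (𝟙 x) = 0 := rfl

theorem grading_comp {x y z : Λ.InfinitePath} (g : x ⟶ y) (h : y ⟶ z) :
    grading (g ≫ h) = grading h + grading g := rfl

variable (Λ)

/-- The set `Z(U, m, n, W)` of the groupoid elements `(y, m - n, x)` with `y ∈ U`, `x ∈ W` and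
`σᵐ(y) = σⁿ(x)`. -/
def groupoidBasicSet (U : Set Λ.InfinitePath) (m n : Fin k → ℕ) (W : Set Λ.InfinitePath) :
    Set (Arrow Λ.InfinitePath) :=
  {g | g.right ∈ U ∧ g.left ∈ W ∧ (grading g.hom = fun j => (m j : ℤ) - (n j : ℤ)) ∧
    g.right.shift m = g.left.shift n}

/-- The topology on the groupoid with basis the sets `Z(U, m, n, W)` with `U`, `W` open. -/
instance : TopologicalSpace (Arrow Λ.InfinitePath) :=
  TopologicalSpace.generateFrom
    {A | ∃ (U W : Set Λ.InfinitePath) (m n : Fin k → ℕ), IsOpen U ∧ IsOpen W ∧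
      A = Λ.groupoidBasicSet U m n W}

/-! ## Points of the torus as characters -/

/-- The monomial `z ^ l = ∏ j, z_j ^ l_j` for `z ∈ 𝕋ᵏ` and `l ∈ ℤᵏ`. -/
noncomputable def monomial (z : Fin k → Circle) (l : Fin k → ℤ) : Circle :=
  ∏ j, z j ^ l j

/-- The map `q : Λ^∞ × 𝕋ᵏ → Stab(𝒢_Λ)^` sending `(x, z)` to `x` with the character
`g ↦ z ^ Φ(g)` of the isotropy group at `x`. -/
noncomputable def toIsotropyChar (a : Λ.InfinitePath × (Fin k → Circle)) :
    IsotropyChar Λ.InfinitePath :=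
  ⟨a.1, { toFun := fun g => monomial a.2 (grading g)
          map_one' := by
            change monomial a.2 (grading (𝟙 a.1)) = 1
            simp [grading_id, monomial]
          map_mul' := fun g h => by
            change monomial a.2 (grading (g ≫ h)) = _
            simp only [grading_comp, monomial, Pi.add_apply, zpow_add, Finset.prod_mul_distrib]
            exact mul_comm _ _ }⟩

/-! ## The conditions on subsets of `Λ⁰ × 𝕋ᵏ` -/

/-- The set `T_y` of all `w ∈ 𝕋ᵏ` with `|z ^ (m - n) - w ^ (m - n)| < ε` for all pairs `(m, n)` in
the finite set `F` with `σᵐ(y) = σⁿ(y)`. -/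
def torusNhd {Λ : KGraph k V} (z : Fin k → Circle) (ε : ℝ)
    (F : Finset ((Fin k → ℕ) × (Fin k → ℕ))) (y : Λ.InfinitePath) : Set (Fin k → Circle) :=
  {w | ∀ p ∈ F, y.shift p.1 = y.shift p.2 →
    ‖(monomial z (fun j => (p.1 j : ℤ) - (p.2 j : ℤ)) : ℂ) -
      (monomial w (fun j => (p.1 j : ℤ) - (p.2 j : ℤ)) : ℂ)‖ < ε}

/-- Every slice of `D` is hereditary and saturated. -/
def SlicesHereditarySaturated (D : Set (V × (Fin k → Circle))) : Prop :=
  ∀ z : Fin k → Circle, Λ.IsHereditary {v | (v, z) ∈ D} ∧ Λ.IsSaturated {v | (v, z) ∈ D}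

/-- The local condition: for all `(v, z) ∈ D` and `x ∈ Z(v)` there are `ε > 0`, `n ∈ ℕᵏ` and a
finite set `F` of pairs `(m', n')` with `σ^{m'}(x) = σ^{n'}(x)` such that for every
`y ∈ Z(x(0, n))` there is `m ∈ ℕᵏ` with `{y(m)} × T_y ⊆ D`. -/
def LocalCondition (D : Set (V × (Fin k → Circle))) : Prop :=
  ∀ (v : V) (z : Fin k → Circle), (v, z) ∈ D → ∀ x ∈ Λ.cylinder (Arrow.mk (𝟙 v)),
    ∃ ε : ℝ, 0 < ε ∧ ∃ (n : Fin k → ℕ) (F : Finset ((Fin k → ℕ) × (Fin k → ℕ))),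
      (∀ p ∈ F, x.shift p.1 = x.shift p.2) ∧
      ∀ y ∈ Λ.cylinder (x.segment 0 n (zero_le)), ∃ m : Fin k → ℕ,
        ({y.vertex m} : Set V) ×ˢ torusNhd z ε F y ⊆ D

end KGraph

/-! The map `q` (`toIsotropyChar`) is onto: `Φ` embeds the isotropy group of `x` in `ℤᵏ`, and
characters of subgroups of `ℤᵏ` extend because the circle is divisible. Conjugation preserves `Φ`,
so the action moves `q(x, z)` to `q(y, z)` with the same `z`. For fixed `z`, an invariant open set
`A` therefore cuts out an invariant open set of infinite paths. Such a set is recorded by a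
hereditary saturated set of vertices, namely those `v` for which it contains all of `Z(v)`
(`vertexSet`). König's lemma (`exists_infinitePath_avoiding`) shows that passing from `D` to
characters and back returns `D`.

Condition (ii) governs how the slices vary with `z`. By compactness, an open set containing `q(x,
z)` contains every `q(y, w)` with `y` close to `x` and `w` close to `z` on those of finitely many
isotropy elements at `x` that persist at `y` (`exists_torusNhd_of_isOpen`); this yields (ii) for
`vertexSet A`. Conversely, (ii) makes the set of pairs attached to `D` a union of fibres of `q`
(`preimage_charSet`). Its image is open (`isOpen_charSet`) because the elements `(y, a - b, y)` with
`σᵃ(y) = σᵇ(y)`, for fixed `a`, `b` and `y` in a cylinder, form a compact set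
(`isCompact_isotropy`). -/

/-- `g` is the concatenation `f h` of the paths `f` and `h`. -/
def IsConcat {V : Type u} [Category.{w} V] (f h g : Arrow V) : Prop :=
  ∃ e : h.right = f.left, g = Arrow.mk (h.hom ≫ eqToHom e ≫ f.hom)

namespace IsConcat

variable {V : Type u} [Category.{w} V]

theorem mk {a b c : V} (h : a ⟶ b) (f : b ⟶ c) :
    IsConcat (Arrow.mk f) (Arrow.mk h) (Arrow.mk (h ≫ f)) :=
  ⟨rfl, by simp⟩

theorem exists_of_eq {f h : Arrow V} (e : h.right = f.left) : ∃ g, IsConcat f h g :=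
  ⟨_, e, rfl⟩

theorem right_eq {f h g : Arrow V} (H : IsConcat f h g) : g.right = f.right := by
  obtain ⟨e, rfl⟩ := H; rfl

theorem left_eq {f h g : Arrow V} (H : IsConcat f h g) : g.left = h.left := by
  obtain ⟨e, rfl⟩ := H; rfl

theorem unique {f h g g' : Arrow V} (H : IsConcat f h g) (H' : IsConcat f h g') : g = g' := by
  obtain ⟨e, rfl⟩ := H
  obtain ⟨e', rfl⟩ := H'
  rfl

theorem exists_hom {f h g : Arrow V} (H : IsConcat f h g) :
    ∃ (a b c : V) (h' : a ⟶ b) (f' : b ⟶ c),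
      f = Arrow.mk f' ∧ h = Arrow.mk h' ∧ g = Arrow.mk (h' ≫ f') := by
  obtain ⟨b, c, f⟩ := f
  obtain ⟨a, b', h⟩ := h
  obtain ⟨e, rfl⟩ := H
  obtain rfl : b' = b := e
  exact ⟨_, _, _, h, f, rfl, rfl, by simp⟩

/-- If `a b = ab` and `(ab) c = abc`, then `abc = a (b c)`. -/
theorem assoc {a b ab c abc : Arrow V} (H : IsConcat a b ab) (H' : IsConcat ab c abc) :
    ∃ bc, IsConcat b c bc ∧ IsConcat a bc abc := by
  obtain ⟨z, y, x, b, a, rfl, rfl, rfl⟩ := H.exists_hom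
  obtain ⟨z', t, c⟩ := c
  obtain ⟨e, rfl⟩ := H'
  dsimp at e c
  subst e
  exact ⟨_, mk c b, by simpa using mk (c ≫ b) a⟩

/-- If `b c = bc` and `a (bc) = abc`, then `abc = (a b) c`. -/
theorem assoc' {a b bc c abc : Arrow V} (H : IsConcat b c bc) (H' : IsConcat a bc abc) :
    ∃ ab, IsConcat a b ab ∧ IsConcat ab c abc := by
  obtain ⟨z, y, x, c, b, rfl, rfl, rfl⟩ := H.exists_hom
  obtain ⟨x', t, a⟩ := a
  obtain ⟨e, rfl⟩ := H'
  obtain rfl : x = x' := e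
  exact ⟨_, mk b a, by simpa using mk c (b ≫ a)⟩

end IsConcat

/-- `f` is an initial segment of the path `g`. -/
def IsInitialPath {V : Type u} [Category.{w} V] (f g : Arrow V) : Prop :=
  ∃ h, IsConcat f h g

theorem IsInitialPath.trans {V : Type u} [Category.{w} V] {f g h : Arrow V}
    (H : IsInitialPath f g) (H' : IsInitialPath g h) : IsInitialPath f h := by
  obtain ⟨a, H⟩ := H
  obtain ⟨b, H'⟩ := H'
  obtain ⟨c, -, hc⟩ := H.assoc H'
  exact ⟨c, hc⟩

/-! ### Unique factorization, and infinite paths as compatible families of finite paths. -/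

namespace KGraph

variable {k : ℕ} {V : Type u} [Category.{w} V] (Λ : KGraph k V)

theorem deg_concat {f h g : Arrow V} (H : IsConcat f h g) :
    Λ.deg g.hom = Λ.deg f.hom + Λ.deg h.hom := by
  obtain ⟨a, b, c, h, f, rfl, rfl, rfl⟩ := H.exists_hom
  exact Λ.deg_comp h f

theorem exists_concat (g : Arrow V) (m n : Fin k → ℕ) (e : Λ.deg g.hom = m + n) :
    ∃ f h, IsConcat f h g ∧ Λ.deg f.hom = m ∧ Λ.deg h.hom = n := by
  obtain ⟨⟨c, h, f⟩, ⟨h1, h2, h3⟩, -⟩ := Λ.factorization g.hom m n e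
  refine ⟨Arrow.mk f, Arrow.mk h, ?_, h2, h3⟩
  dsimp only at h1
  have := IsConcat.mk h f
  rw [h1] at this
  exact this

/-- Additivity of the degree forces `h` and `h'` to have equal degrees as well, so the factorization
property applies. -/
theorem concat_unique {f h f' h' g : Arrow V} (H : IsConcat f h g) (H' : IsConcat f' h' g)
    (e : Λ.deg f.hom = Λ.deg f'.hom) : f = f' ∧ h = h' := by
  have d := Λ.deg_concat H
  have d' := Λ.deg_concat H'
  have e' : Λ.deg h.hom = Λ.deg h'.hom := by
    rw [d, e] at d'
    exact add_left_cancel d'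
  obtain ⟨a, b, c, h, f, rfl, rfl, rfl⟩ := H.exists_hom
  obtain ⟨b', c', f'⟩ := f'
  obtain ⟨a', b'', h'⟩ := h'
  obtain ⟨i, j⟩ := H'
  obtain rfl : b'' = b' := i
  obtain rfl : a = a' := congrArg (fun t : Arrow V => t.left) j
  obtain rfl : c = c' := congrArg (fun t : Arrow V => t.right) j
  have j' : h ≫ f = h' ≫ f' := by
    have := Arrow.mk_injective _ _ j
    simpa using this
  have := (Λ.factorization (h ≫ f) _ _ (Λ.deg_comp h f)).unique
    (y₁ := ⟨b, h, f⟩) (y₂ := ⟨b'', h', f'⟩) ⟨rfl, rfl, rfl⟩ ⟨j'.symm, e.symm, e'.symm⟩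
  cases this
  exact ⟨rfl, rfl⟩

theorem initial_unique {f f' g : Arrow V} (H : IsInitialPath f g) (H' : IsInitialPath f' g)
    (e : Λ.deg f.hom = Λ.deg f'.hom) : f = f' := by
  obtain ⟨h, H⟩ := H
  obtain ⟨h', H'⟩ := H'
  exact (Λ.concat_unique H H' e).1

theorem exists_initial (g : Arrow V) (n : Fin k → ℕ) (hn : n ≤ Λ.deg g.hom) :
    ∃ f, IsInitialPath f g ∧ Λ.deg f.hom = n := by
  obtain ⟨f, h, H, e, -⟩ := Λ.exists_concat g n (Λ.deg g.hom - n) (by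
    exact (add_tsub_cancel_of_le hn).symm)
  exact ⟨f, ⟨h, H⟩, e⟩

/-- The initial segment of `f'` of degree `d(f)` is also one of `g`, hence equals `f`. -/
theorem initial_of_le {f f' g : Arrow V} (H : IsInitialPath f g) (H' : IsInitialPath f' g)
    (e : Λ.deg f.hom ≤ Λ.deg f'.hom) : IsInitialPath f f' := by
  obtain ⟨f'', H2, e2⟩ := Λ.exists_initial f' _ e
  rwa [Λ.initial_unique H (H2.trans H') e2.symm]

/-- Both `f · id` and `id · f` factor `f` with first factor of degree `0`. -/
theorem eq_id_of_deg_eq_zero {a b : V} (f : a ⟶ b) (hf : Λ.deg f = 0) :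
    Arrow.mk f = Arrow.mk (𝟙 b) ∧ a = b := by
  have h1 : IsConcat (Arrow.mk f) (Arrow.mk (𝟙 a)) (Arrow.mk f) := by
    simpa using IsConcat.mk (𝟙 a) f
  have h2 : IsConcat (Arrow.mk (𝟙 b)) (Arrow.mk f) (Arrow.mk f) := by
    simpa using IsConcat.mk f (𝟙 b)
  have h := (Λ.concat_unique h1 h2 (by
    change Λ.deg f = Λ.deg (𝟙 b); rw [hf, Λ.deg_id])).1
  exact ⟨h, congrArg (fun t : Arrow V => t.left) h⟩

namespace InfinitePath

variable {Λ}

/-- The initial segment `x(0, n)`. -/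
abbrev initialSegment (x : Λ.InfinitePath) (n : Fin k → ℕ) : Arrow V :=
  x.segment 0 n (zero_le)

theorem deg_segment (x : Λ.InfinitePath) (p q : Fin k → ℕ) (h : p ≤ q) :
    Λ.deg (x.segment p q h).hom = q - p :=
  x.deg_map p q h

theorem deg_initialSegment (x : Λ.InfinitePath) (n : Fin k → ℕ) :
    Λ.deg (x.initialSegment n).hom = n := by
  rw [deg_segment]; exact tsub_zero n

theorem isConcat_segment (x : Λ.InfinitePath) (p q r : Fin k → ℕ) (h : p ≤ q) (h' : q ≤ r) :
    IsConcat (x.segment p q h) (x.segment q r h') (x.segment p r (h.trans h')) := by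
  have := IsConcat.mk (x.segment q r h').hom (x.segment p q h).hom
  simp only [segment, Arrow.mk_hom, ← Functor.map_comp] at this
  exact this

theorem isInitial_initialSegment (x : Λ.InfinitePath) {m n : Fin k → ℕ} (h : m ≤ n) :
    IsInitialPath (x.initialSegment m) (x.initialSegment n) :=
  ⟨_, x.isConcat_segment 0 m n (zero_le) h⟩

theorem segment_congr (x : Λ.InfinitePath) {p q p' q' : Fin k → ℕ} (hp : p = p') (hq : q = q')
    (h : p ≤ q) : x.segment p q h = x.segment p' q' (hp ▸ hq ▸ h) := by
  subst hp hq; rfl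

theorem vertex_shift (x : Λ.InfinitePath) (n p : Fin k → ℕ) :
    (x.shift n).vertex p = x.vertex (n + p) := rfl

theorem isConcat_shift (x : Λ.InfinitePath) (m n : Fin k → ℕ) :
    IsConcat (x.initialSegment m) ((x.shift m).initialSegment n) (x.initialSegment (m + n)) := by
  have := x.isConcat_segment 0 m (m + n) (zero_le) le_self_add
  rw [x.segment_congr (add_zero m).symm rfl] at this
  exact this

/-- The segment `x(p, q)` is recovered as the cofactor of `x(0, p)` in `x(0, q)`. -/
theorem ext_initialSegment {x y : Λ.InfinitePath}
    (h : ∀ n, x.initialSegment n = y.initialSegment n) : x = y := by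
  apply InfinitePath.ext
  have key : ∀ (p q : Fin k → ℕ) (hpq : p ≤ q), x.segment p q hpq = y.segment p q hpq := by
    intro p q hpq
    have h1 := x.isConcat_segment 0 p q (zero_le) hpq
    have h2 := y.isConcat_segment 0 p q (zero_le) hpq
    have h3 := h q
    have h4 := h p
    dsimp only [initialSegment] at h3 h4
    rw [h3, h4] at h1
    exact (Λ.concat_unique h1 h2 rfl).2
  refine Functor.hext (fun p => congrArg (fun t : Arrow V => t.left) (h (OrderDual.ofDual p)))
    fun p q f => ?_
  have hk := key (OrderDual.ofDual q) (OrderDual.ofDual p) (leOfHom f)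
  have hf : f = homOfLE (leOfHom f) := Subsingleton.elim _ _
  rw [hf]
  have aux : ∀ (a b a' b' : V) (f : a ⟶ b) (f' : a' ⟶ b'), Arrow.mk f = Arrow.mk f' → HEq f f' := by
    intro a b a' b' f f' e
    cases e; rfl
  exact aux _ _ _ _ _ _ hk

theorem eq_of_shift_eq {x y : Λ.InfinitePath} (n : Fin k → ℕ)
    (h : x.initialSegment n = y.initialSegment n) (h' : x.shift n = y.shift n) : x = y := by
  refine ext_initialSegment fun p => ?_
  have h1 := x.isConcat_shift n p
  have h2 := y.isConcat_shift n p
  rw [h, h'] at h1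
  have e := h1.unique h2
  have h3 := x.isInitial_initialSegment (m := p) (n := n + p) le_add_self
  rw [e] at h3
  exact Λ.initial_unique h3 (y.isInitial_initialSegment (m := p) (n := n + p) le_add_self)
    (by rw [deg_initialSegment, deg_initialSegment])

/-- A compatible family of paths is the family of the initial segments of an infinite path. -/
theorem exists_of_family (F : (Fin k → ℕ) → Arrow V) (hF : ∀ n, Λ.deg (F n).hom = n)
    (hF' : ∀ m n, m ≤ n → IsInitialPath (F m) (F n)) :
    ∃ x : Λ.InfinitePath, ∀ n, x.initialSegment n = F n := by
  have H : ∀ m n, m ≤ n → ∃ h : (F n).left ⟶ (F m).left, IsConcat (F m) (Arrow.mk h) (F n) := by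
    intro m n hmn
    obtain ⟨h, hh⟩ := hF' m n hmn
    have e1 := hh.left_eq
    obtain ⟨a, b, h⟩ := h
    have e2 := hh.choose
    dsimp at e1 e2 h
    subst e1 e2
    exact ⟨h, hh⟩
  choose h hh using H
  have uniq : ∀ m n (hmn : m ≤ n) (g : (F n).left ⟶ (F m).left),
      IsConcat (F m) (Arrow.mk g) (F n) → g = h m n hmn := fun m n hmn g hg =>
    Arrow.mk_injective _ _ (Λ.concat_unique hg (hh m n hmn) rfl).2
  let x : Λ.InfinitePath :=
    { toFunctor :=
        { obj := fun n => (F (OrderDual.ofDual n)).left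
          map := fun {p q} f => h (OrderDual.ofDual q) (OrderDual.ofDual p) (leOfHom f)
          map_id := fun p => by
            refine (uniq _ _ _ _ ?_).symm
            have := IsConcat.mk (𝟙 _) (F (OrderDual.ofDual p)).hom
            rw [Category.id_comp] at this
            exact this
          map_comp := fun {p q r} f g => by
            refine (uniq _ _ _ _ ?_).symm
            obtain ⟨c, hc, hc'⟩ := (hh _ _ (leOfHom g)).assoc (hh _ _ (leOfHom f))
            rwa [hc.unique (IsConcat.mk _ _)] at hc' }
      deg_map := fun p q hpq => by
        have := Λ.deg_concat (hh p q hpq)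
        rw [hF, hF] at this
        change Λ.deg (h p q hpq) = q - p
        change q = p + Λ.deg (h p q hpq) at this
        conv_rhs => rw [this]
        exact (add_tsub_cancel_left _ _).symm }
  refine ⟨x, fun n => ?_⟩
  have h1 : IsConcat (F 0) (x.initialSegment n) (F n) := hh 0 n (zero_le)
  -- `F 0` has degree `0`, so it is an identity and the cofactor of `F 0` in `F n` is `F n` itself.
  obtain ⟨h2, h3⟩ := Λ.eq_id_of_deg_eq_zero (F 0).hom (hF 0)
  have h4 : F 0 = Arrow.mk (𝟙 (F 0).right) := h2
  rw [h4] at h1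
  have h5 : IsConcat (Arrow.mk (𝟙 (x.initialSegment n).right)) (x.initialSegment n)
      (x.initialSegment n) := by
    have := IsConcat.mk (x.initialSegment n).hom (𝟙 _)
    rw [Category.comp_id] at this
    exact this
  have h6 : (x.initialSegment n).right = (F 0).right := h3
  rw [h6] at h5
  exact h5.unique h1

/-- The concatenation of a path and an infinite path. -/
theorem exists_concat (f : Arrow V) (x : Λ.InfinitePath) (h : x.vertex 0 = f.left) :
    ∃ y : Λ.InfinitePath, y.initialSegment (Λ.deg f.hom) = f ∧ y.shift (Λ.deg f.hom) = x := by
  set d := Λ.deg f.hom with hd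
  have H : ∀ n, ∃ g, IsConcat f (x.initialSegment n) g := fun n => IsConcat.exists_of_eq h
  choose G hG using H
  have dG : ∀ n, Λ.deg (G n).hom = d + n := fun n => by
    rw [Λ.deg_concat (hG n), deg_initialSegment]
  have G_mono : ∀ m n, m ≤ n → IsInitialPath (G m) (G n) := by
    intro m n hmn
    obtain ⟨b, hb⟩ := x.isInitial_initialSegment hmn
    obtain ⟨ab, h1, h2⟩ := IsConcat.assoc' hb (hG n)
    rw [h1.unique (hG m)] at h2
    exact ⟨_, h2⟩
  -- `G n` has degree `d + n`; truncating it to degree `n` gives a family indexed by its own degree.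
  have H : ∀ n, ∃ g, IsInitialPath g (G n) ∧ Λ.deg g.hom = n := fun n =>
    Λ.exists_initial (G n) n (by rw [dG]; exact le_add_self)
  choose F hF dF using H
  obtain ⟨y, hy⟩ := exists_of_family (Λ := Λ) F dF fun m n hmn =>
    Λ.initial_of_le ((hF m).trans (G_mono m n hmn)) (hF n) (by rwa [dF, dF])
  have e1 : y.initialSegment d = f := by
    rw [hy]
    exact Λ.initial_unique (hF d) ⟨_, hG d⟩ (by rw [dF])
  refine ⟨y, e1, ext_initialSegment fun n => ?_⟩
  have e2 : y.initialSegment (d + n) = G n := by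
    rw [hy]
    exact Λ.initial_unique (hF (d + n)) (G_mono n (d + n) le_add_self) (by rw [dF, dG])
  have h1 := y.isConcat_shift d n
  rw [e1, e2] at h1
  exact (Λ.concat_unique h1 (hG n) rfl).2

end InfinitePath
end KGraph

/-! ### Topology of the space of infinite paths, and König's lemma. -/

namespace KGraph

open Filter Topology

variable {k : ℕ} {V : Type u} [Category.{w} V] {Λ : KGraph k V}

namespace InfinitePath

/-- The set of the infinite paths with the same initial segment of degree `n` as `x`. -/
def basicNhd (x : Λ.InfinitePath) (n : Fin k → ℕ) : Set Λ.InfinitePath :=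
  {y | y.initialSegment n = x.initialSegment n}

theorem cylinder_eq (f : Arrow V) :
    Λ.cylinder f = {x | x.initialSegment (Λ.deg f.hom) = f} := rfl

theorem cylinder_initialSegment (x : Λ.InfinitePath) (n : Fin k → ℕ) :
    Λ.cylinder (x.initialSegment n) = x.basicNhd n := by
  rw [cylinder_eq, deg_initialSegment]; rfl

theorem mem_basicNhd_self (x : Λ.InfinitePath) (n : Fin k → ℕ) : x ∈ x.basicNhd n := rfl

theorem basicNhd_anti (x : Λ.InfinitePath) {m n : Fin k → ℕ} (h : m ≤ n) :
    x.basicNhd n ⊆ x.basicNhd m := by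
  intro y hy
  have h1 := y.isInitial_initialSegment h
  rw [show y.initialSegment n = x.initialSegment n from hy] at h1
  exact Λ.initial_unique h1 (x.isInitial_initialSegment h)
    (by rw [deg_initialSegment, deg_initialSegment])

theorem vertex_eq_of_mem_basicNhd {x y : Λ.InfinitePath} {n : Fin k → ℕ}
    (h : y ∈ x.basicNhd n) : y.vertex n = x.vertex n :=
  congrArg (fun t : Arrow V => t.left) h

theorem initialSegment_zero (x : Λ.InfinitePath) :
    x.initialSegment 0 = Arrow.mk (𝟙 (x.vertex 0)) := by
  have h : Λ.deg (x.initialSegment 0).hom = 0 := x.deg_initialSegment 0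
  exact (Λ.eq_id_of_deg_eq_zero _ h).1

theorem mem_cylinder_id {v : V} {x : Λ.InfinitePath} :
    x ∈ Λ.cylinder (Arrow.mk (𝟙 v)) ↔ x.vertex 0 = v := by
  rw [cylinder_eq]
  have : Λ.deg (Arrow.mk (𝟙 v)).hom = 0 := Λ.deg_id v
  rw [Set.mem_ofPred_eq, this, initialSegment_zero]
  constructor
  · exact fun h => congrArg (fun t : Arrow V => t.left) h
  · rintro rfl; rfl

theorem isOpen_basicNhd (x : Λ.InfinitePath) (n : Fin k → ℕ) : IsOpen (x.basicNhd n) := by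
  rw [← cylinder_initialSegment]
  exact TopologicalSpace.isOpen_generateFrom_of_mem ⟨_, rfl⟩

theorem basicNhd_mem_nhds (x : Λ.InfinitePath) (n : Fin k → ℕ) : x.basicNhd n ∈ 𝓝 x :=
  (x.isOpen_basicNhd n).mem_nhds (x.mem_basicNhd_self n)

/-- Cylinders around `x` shrink as the degree grows, so `m ⊔ n` handles intersections and the
generating sets already form a basis. -/
theorem exists_basicNhd_subset {U : Set Λ.InfinitePath} (hU : IsOpen U) {x : Λ.InfinitePath}
    (hx : x ∈ U) : ∃ n, x.basicNhd n ⊆ U := by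
  induction hU with
  | basic A hA =>
    obtain ⟨f, rfl⟩ := hA
    refine ⟨Λ.deg f.hom, ?_⟩
    rw [← cylinder_initialSegment,
      show x.initialSegment (Λ.deg f.hom) = f from hx]
  | univ => exact ⟨0, Set.subset_univ _⟩
  | inter A B _ _ hA hB =>
    obtain ⟨m, hm⟩ := hA hx.1
    obtain ⟨n, hn⟩ := hB hx.2
    exact ⟨m ⊔ n, Set.subset_inter ((x.basicNhd_anti le_sup_left).trans hm)
      ((x.basicNhd_anti le_sup_right).trans hn)⟩
  | sUnion S _ hS =>
    obtain ⟨A, hA, hxA⟩ := hx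
    obtain ⟨n, hn⟩ := hS A hA hxA
    exact ⟨n, hn.trans (Set.subset_sUnion_of_mem hA)⟩

theorem nhds_hasBasis (x : Λ.InfinitePath) : (𝓝 x).HasBasis (fun _ => True) x.basicNhd := by
  refine ⟨fun U => ⟨fun hU => ?_, fun ⟨n, _, h⟩ => mem_of_superset (x.basicNhd_mem_nhds n) h⟩⟩
  obtain ⟨U', h1, h2, h3⟩ := mem_nhds_iff.1 hU
  obtain ⟨n, hn⟩ := exists_basicNhd_subset h2 h3
  exact ⟨n, trivial, hn.trans h1⟩

instance : T2Space Λ.InfinitePath := by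
  refine ⟨fun x y hxy => ?_⟩
  have : ∃ n, x.initialSegment n ≠ y.initialSegment n := by
    by_contra! h
    exact hxy (ext_initialSegment h)
  obtain ⟨n, hn⟩ := this
  refine ⟨_, _, x.isOpen_basicNhd n, y.isOpen_basicNhd n, rfl, rfl, ?_⟩
  rw [Set.disjoint_left]
  intro z hz hz'
  exact hn (Eq.trans (Eq.symm hz) hz')

theorem isClosed_basicNhd (x : Λ.InfinitePath) (n : Fin k → ℕ) : IsClosed (x.basicNhd n) := by
  rw [← isOpen_compl_iff, isOpen_iff_mem_nhds]
  intro y hy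
  filter_upwards [y.basicNhd_mem_nhds n] with z hz hz'
  exact hy (Eq.trans (Eq.symm hz) hz')

theorem shift_mem_basicNhd {x y : Λ.InfinitePath} {m n : Fin k → ℕ}
    (h : y ∈ x.basicNhd (m + n)) : y.shift m ∈ (x.shift m).basicNhd n := by
  have h1 := y.isConcat_shift m n
  have h0 : y.initialSegment m = x.initialSegment m := x.basicNhd_anti le_self_add h
  rw [show y.initialSegment (m + n) = x.initialSegment (m + n) from h, h0] at h1
  exact (Λ.concat_unique h1 (x.isConcat_shift m n) rfl).2

theorem continuous_shift (m : Fin k → ℕ) : Continuous (shift m : Λ.InfinitePath → _) := by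
  refine continuous_iff_continuousAt.2 fun x => ?_
  refine (x.nhds_hasBasis.tendsto_iff (nhds_hasBasis _)).2 fun n _ => ⟨m + n, trivial, ?_⟩
  exact fun y hy => shift_mem_basicNhd hy

/-- By row-finiteness an ultrafilter on `Z(x(0))` selects one path in each degree. The selected
paths are compatible because any two members of the ultrafilter meet, and the infinite path they
define is the limit. -/
theorem isCompact_basicNhd (hΛ : Λ.RowFiniteNoSources) (x : Λ.InfinitePath) (n : Fin k → ℕ) :
    IsCompact (x.basicNhd n) := by
  suffices h : IsCompact (x.basicNhd 0) from
    h.of_isClosed_subset (x.isClosed_basicNhd n) (x.basicNhd_anti (zero_le))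
  rw [isCompact_iff_ultrafilter_le_nhds]
  intro F hF
  rw [le_principal_iff] at hF
  have H : ∀ m, ∃ f ∈ Λ.pathsTo (x.vertex 0) m, {y : Λ.InfinitePath | y.initialSegment m = f} ∈ F := by
    intro m
    have := (Ultrafilter.finite_biUnion_mem_iff (f := F) (hΛ (x.vertex 0) m).1
      (s := fun f => {y : Λ.InfinitePath | y.initialSegment m = f})).1
    obtain ⟨f, hf, hf'⟩ := this (by
      refine mem_of_superset hF fun y hy => ?_
      refine Set.mem_biUnion (x := y.initialSegment m) ⟨?_, y.deg_initialSegment m⟩ rfl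
      exact vertex_eq_of_mem_basicNhd hy)
    exact ⟨f, hf, hf'⟩
  choose f hf hfF using H
  obtain ⟨z, hz⟩ := exists_of_family (Λ := Λ) f (fun m => (hf m).2) fun m n hmn => by
    obtain ⟨y, hy, hy'⟩ := F.nonempty_of_mem (inter_mem (hfF m) (hfF n))
    rw [← show _ = f m from hy, ← show _ = f n from hy']
    exact y.isInitial_initialSegment hmn
  refine ⟨z, ?_, ?_⟩
  · obtain ⟨y, hy, hy'⟩ := F.nonempty_of_mem (inter_mem (hfF 0) hF)
    exact Eq.trans (hz 0) (Eq.trans (Eq.symm hy) hy')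
  · refine z.nhds_hasBasis.ge_iff.2 fun m _ => ?_
    refine mem_of_superset (hfF m) fun y hy => ?_
    exact Eq.trans hy (hz m).symm

/-- The equality `σᵃ(y) = σᵇ(y)` determines whether `σᵐ(y) = σⁿ(y)` on small open sets if
`a - b = m - n`. -/
theorem shift_eq_shift_of_mem_basicNhd {x y x' y' : Λ.InfinitePath} {a b m n : Fin k → ℕ}
    (h : a + n = b + m) (hxy : y.shift m = x.shift n) (hy : y' ∈ y.basicNhd (m + a))
    (hx : x' ∈ x.basicNhd (n + a)) (hxy' : y'.shift a = x'.shift b) :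
    y'.shift m = x'.shift n := by
  -- The two sides agree up to degree `a` because `y'` and `x'` are close to `y` and `x`, and beyond
  -- it because `a + n = b + m`.
  refine eq_of_shift_eq a ?_ ?_
  · have h1 : (y'.shift m).initialSegment a = (y.shift m).initialSegment a := shift_mem_basicNhd hy
    have h2 : (x'.shift n).initialSegment a = (x.shift n).initialSegment a := shift_mem_basicNhd hx
    rw [h1, h2, hxy]
  · rw [shift_shift, add_comm a m, ← shift_shift, hxy', shift_shift, shift_shift, h, add_comm]

end InfinitePath

/-- König's lemma: a vertex outside of a hereditary and saturated set is the range of an infinite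
path that does not meet this set. -/
theorem exists_infinitePath_avoiding (hΛ : Λ.RowFiniteNoSources) {H : Set V}
    (h1 : Λ.IsHereditary H) (h2 : Λ.IsSaturated H) {v : V} (hv : v ∉ H) :
    ∃ x : Λ.InfinitePath, x.vertex 0 = v ∧ ∀ n, x.vertex n ∉ H := by
  -- The paths from `v` that end outside `H` form an inverse system: truncation stays outside `H` by
  -- heredity, each level is nonempty by saturation and finite by row-finiteness.
  let S : (Fin k → ℕ) → Set (Arrow V) := fun n => {f | f ∈ Λ.pathsTo v n ∧ f.left ∉ H}
  have hr : ∀ m n, m ≤ n → ∀ f : S n, ∃ g : S m, IsInitialPath g.1 f.1 := by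
    rintro m n hmn ⟨f, ⟨hf, hf'⟩, hf''⟩
    obtain ⟨g, ⟨h, hg⟩, hg'⟩ := Λ.exists_initial f m (by rwa [hf'])
    refine ⟨⟨g, ⟨hg.right_eq ▸ hf, hg'⟩, fun hgH => hf'' ?_⟩, h, hg⟩
    rw [hg.left_eq]
    refine h1 h ?_
    rwa [hg.choose]
  choose r hr using hr
  have uniq : ∀ m n (hmn : m ≤ n) (f : S n) (g : S m), IsInitialPath g.1 f.1 → r m n hmn f = g :=
    fun m n hmn f g hg => Subtype.ext
      (Λ.initial_unique (hr m n hmn f) hg ((r m n hmn f).2.1.2.trans g.2.1.2.symm))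
  let _ : Category (Fin k → ℕ) := Preorder.smallCategory _
  let F : (Fin k → ℕ)ᵒᵖ ⥤ Type (max u w) :=
    { obj := fun n => S n.unop
      map := fun {p q} f => ↾(r q.unop p.unop (leOfHom f.unop))
      map_id := fun p => by
        ext f
        refine congrArg Subtype.val (uniq _ _ _ f f ⟨Arrow.mk (𝟙 f.1.left), ?_⟩)
        have := IsConcat.mk (𝟙 _) f.1.hom
        rw [Category.id_comp] at this
        exact this
      map_comp := fun {a b c} f g => by
        ext x
        exact congrArg Subtype.val (uniq _ _ _ x _ ((hr _ _ _ _).trans (hr _ _ _ _))) }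
  have : ∀ j, Finite (F.obj j) := fun j => ((hΛ v j.unop).1.subset fun f hf => hf.1).to_subtype
  have : ∀ j, Nonempty (F.obj j) := fun j => by
    by_contra hj
    refine hv (h2 v j.unop fun f hf => ?_)
    by_contra hfH
    exact hj ⟨⟨f, hf, hfH⟩⟩
  obtain ⟨s, hs⟩ := nonempty_sections_of_finite_inverse_system F
  let s' : ∀ n, S n := fun n => s (Opposite.op n)
  obtain ⟨x, hx⟩ := InfinitePath.exists_of_family (Λ := Λ) (fun n => (s' n).1)
    (fun n => (s' n).2.1.2) fun m n hmn => by
      have h3 : r m n hmn (s' n) = s' m := hs (homOfLE hmn).op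
      have h4 := hr m n hmn (s' n)
      rwa [h3] at h4
  have hxv : ∀ n, x.vertex n = (s' n).1.left := fun n => congrArg (fun t : Arrow V => t.left) (hx n)
  refine ⟨x, ?_, fun n => ?_⟩
  · exact (congrArg (fun t : Arrow V => t.right) (hx 0)).trans (s' 0).2.1.1
  · rw [hxv]; exact (s' n).2.2

end KGraph

/-! ### Characters of the isotropy groups as points of the torus. -/

/-- Every character of a subgroup of `ℤᵏ` is given by a point of the torus. -/
theorem exists_monomial_eq {k : ℕ} (H : AddSubgroup (Fin k → ℤ)) (χ : H →+ Additive Circle) :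
    ∃ z : Fin k → Circle, ∀ l : H, Additive.ofMul (KGraph.monomial z l) = χ l := by
  -- Roots in the circle come from dividing the argument. Divisible groups are injective, so `χ`
  -- extends to `ψ` on `ℤᵏ`.
  let _ : DivisibleBy (Additive Circle) ℤ :=
    { div := fun a n => Additive.ofMul (Circle.exp (Complex.arg (a.toMul : ℂ) / n))
      div_zero := fun a => by simp
      div_cancel := fun {n} a hn => by
        rw [← ofMul_zpow, ← Circle.exp_zsmul, zsmul_eq_mul, mul_div_cancel₀ _ (Int.cast_ne_zero.2 hn),
          Circle.exp_arg]
        rfl }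
  obtain ⟨ψ, hψ⟩ := (Module.Baer.of_divisible (Additive Circle)).extension_property_addMonoidHom
    H.subtype H.subtype_injective χ
  refine ⟨fun j => (ψ (Pi.single j 1)).toMul, fun l => ?_⟩
  rw [← hψ, AddMonoidHom.comp_apply, AddSubgroup.subtype_apply]
  conv_rhs => rw [← Finset.univ_sum_single (l : Fin k → ℤ), map_sum]
  rw [KGraph.monomial, ofMul_prod]
  refine Finset.sum_congr rfl fun j _ => ?_
  rw [ofMul_zpow, ofMul_toMul, ← map_zsmul, ← Pi.single_smul, smul_eq_mul, mul_one]

theorem Circle.dist_eq_norm_sub (a b : Circle) : dist a b = ‖(a : ℂ) - b‖ :=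
  dist_eq_norm (a : ℂ) b

theorem KGraph.continuous_monomial {k : ℕ} (l : Fin k → ℤ) :
    Continuous fun z : Fin k → Circle => monomial z l := by
  unfold KGraph.monomial
  fun_prop

namespace KGraph

open Filter Topology

variable {k : ℕ} {V : Type u} [Category.{w} V] {Λ : KGraph k V}

/-- The vector `m - n ∈ ℤᵏ`. -/
abbrev degDiff (m n : Fin k → ℕ) : Fin k → ℤ := fun j => (m j : ℤ) - (n j : ℤ)

/-- The element `(y, m - n, x)` of the groupoid. -/
def groupoidHom {x y : Λ.InfinitePath} (m n : Fin k → ℕ) (h : y.shift m = x.shift n) : x ⟶ y :=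
  (⟨degDiff m n, m, n, rfl, h⟩ : Λ.GroupoidHom x y)

theorem exists_eq_groupoidHom {x y : Λ.InfinitePath} (g : x ⟶ y) :
    ∃ (m n : Fin k → ℕ) (h : y.shift m = x.shift n), g = groupoidHom m n h := by
  obtain ⟨l, m, n, rfl, h⟩ := (show Λ.GroupoidHom x y from g)
  exact ⟨m, n, h, rfl⟩

theorem grading_injective {x y : Λ.InfinitePath} {g h : x ⟶ y} (e : grading g = grading h) :
    g = h := Subtype.ext e

theorem toIsotropyChar_eq_iff {x : Λ.InfinitePath} {z z' : Fin k → Circle} :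
    Λ.toIsotropyChar (x, z) = Λ.toIsotropyChar (x, z') ↔
      ∀ m n, x.shift m = x.shift n → monomial z (degDiff m n) = monomial z' (degDiff m n) := by
  constructor
  · intro h m n hmn
    have h1 : (Λ.toIsotropyChar (x, z)).2 = (Λ.toIsotropyChar (x, z')).2 :=
      eq_of_heq (Sigma.mk.inj h).2
    exact DFunLike.congr_fun h1 (groupoidHom m n hmn)
  · intro h
    refine Sigma.ext rfl (heq_of_eq (MonoidHom.ext fun g => ?_))
    obtain ⟨m, n, hmn, rfl⟩ := exists_eq_groupoidHom g
    exact h m n hmn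

/-- The grading identifies the isotropy group with a subgroup of `ℤᵏ`, to which `exists_monomial_eq`
applies. -/
theorem exists_toIsotropyChar_eq (c : IsotropyChar Λ.InfinitePath) :
    ∃ z, Λ.toIsotropyChar (c.1, z) = c := by
  obtain ⟨x, χ⟩ := c
  let H : AddSubgroup (Fin k → ℤ) :=
    { carrier := {l | ∃ g : x ⟶ x, grading g = l}
      zero_mem' := ⟨𝟙 x, rfl⟩
      add_mem' := by
        rintro _ _ ⟨g, rfl⟩ ⟨h, rfl⟩
        exact ⟨h ≫ g, rfl⟩
      neg_mem' := by
        rintro _ ⟨g, rfl⟩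
        exact ⟨Groupoid.inv g, rfl⟩ }
  choose σ hσ using fun l : H => l.2
  obtain ⟨z, hz⟩ := exists_monomial_eq H
    { toFun := fun l => Additive.ofMul (χ (σ l))
      map_zero' := by
        rw [← ofMul_one, ← map_one χ]
        congr 2
        exact grading_injective (hσ 0)
      map_add' := fun a b => by
        rw [← ofMul_mul, ← map_mul]
        congr 2
        refine grading_injective ?_
        change _ = grading (σ a ≫ σ b)
        rw [grading_comp, hσ, hσ, hσ, add_comm]
        rfl }
  refine ⟨z, Sigma.ext rfl (heq_of_eq (MonoidHom.ext fun g => ?_))⟩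
  have h1 : monomial z (grading g) = χ (σ ⟨grading g, g, rfl⟩) :=
    Additive.ofMul.injective (hz ⟨grading g, g, rfl⟩)
  rw [grading_injective (hσ ⟨grading g, g, rfl⟩)] at h1
  exact h1

/-- Conjugation does not change the degree because `ℤᵏ` is abelian. -/
theorem act_toIsotropyChar {x y : Λ.InfinitePath} (g : x ⟶ y) (z : Fin k → Circle) :
    IsotropyChar.act g (Λ.toIsotropyChar (x, z)).2 = Λ.toIsotropyChar (y, z) := by
  refine Sigma.ext rfl (heq_of_eq (MonoidHom.ext fun (h : y ⟶ y) => ?_))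
  change monomial z (grading (g ≫ h ≫ Groupoid.inv g)) = monomial z (grading h)
  rw [grading_comp, grading_comp, add_right_comm,
    show grading (Groupoid.inv g) = - grading g from rfl, neg_add_cancel, zero_add]

theorem _root_.IsotropyChar.IsInvariant.toIsotropyChar_mem
    {A : Set (IsotropyChar Λ.InfinitePath)} (hA : IsotropyChar.IsInvariant A)
    {x y : Λ.InfinitePath} {m n : Fin k → ℕ} (h : y.shift m = x.shift n) {z : Fin k → Circle}
    (hx : Λ.toIsotropyChar (x, z) ∈ A) : Λ.toIsotropyChar (y, z) ∈ A := by
  rw [← act_toIsotropyChar (groupoidHom m n h)]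
  exact hA _ _ _ _ hx

/-! ### The topology of the groupoid -/

theorem isOpen_groupoidBasicSet (m n : Fin k → ℕ) {U W : Set Λ.InfinitePath} (hU : IsOpen U)
    (hW : IsOpen W) : IsOpen (Λ.groupoidBasicSet U m n W) :=
  TopologicalSpace.isOpen_generateFrom_of_mem ⟨U, W, m, n, hU, hW, rfl⟩

theorem continuous_left : Continuous fun g : Arrow Λ.InfinitePath => g.left := by
  refine continuous_def.2 fun U hU => isOpen_iff_mem_nhds.2 fun g hg => ?_
  obtain ⟨m, n, h, e⟩ := exists_eq_groupoidHom g.hom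
  refine mem_of_superset ((isOpen_groupoidBasicSet m n isOpen_univ hU).mem_nhds
    ⟨trivial, hg, ?_, h⟩) fun g' hg' => hg'.2.1
  rw [e]; rfl

/-- The elements of a compact set of isotropy near a given unit come from its elements at this
unit. -/
theorem exists_finset_of_isCompact {K : Set (Arrow Λ.InfinitePath)} (hK : IsCompact K)
    (hK' : ∀ g ∈ K, g.left = g.right) (x : Λ.InfinitePath) :
    ∃ (n : Fin k → ℕ) (F : Finset ((Fin k → ℕ) × (Fin k → ℕ))),
      (∀ p ∈ F, x.shift p.1 = x.shift p.2 ∧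
        ∃ g : x ⟶ x, Arrow.mk g ∈ K ∧ grading g = degDiff p.1 p.2) ∧
      ∀ y ∈ x.basicNhd n, ∀ g : y ⟶ y, Arrow.mk g ∈ K →
        ∃ p ∈ F, grading g = degDiff p.1 p.2 ∧ y.shift p.1 = y.shift p.2 := by
  classical
  let S : Set ((Fin k → ℕ) × (Fin k → ℕ)) := {p | x.shift p.1 = x.shift p.2 ∧
    ∃ g : x ⟶ x, Arrow.mk g ∈ K ∧ grading g = degDiff p.1 p.2}
  -- The cover has two kinds of open sets: basic sets through elements of `K` at `x`, and elements
  -- whose unit lies outside a cylinder around `x`.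
  let C : S ⊕ (Fin k → ℕ) → Set (Arrow Λ.InfinitePath) :=
    Sum.elim (fun p => Λ.groupoidBasicSet Set.univ p.1.1 p.1.2 Set.univ)
      (fun n => (fun g => g.left) ⁻¹' (x.basicNhd n)ᶜ)
  obtain ⟨t, ht⟩ := hK.elim_finite_subcover C
    (by
      rintro (p | n)
      · exact isOpen_groupoidBasicSet _ _ isOpen_univ isOpen_univ
      · exact (x.isClosed_basicNhd n).isOpen_compl.preimage continuous_left)
    (by
      intro g hg
      have hlr := hK' g hg
      obtain ⟨y, y', g⟩ := g
      obtain rfl : y = y' := hlr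
      refine Set.mem_iUnion.2 ?_
      by_cases hy : y = x
      · subst hy
        obtain ⟨m, n, h, rfl⟩ := exists_eq_groupoidHom g
        exact ⟨Sum.inl ⟨(m, n), h, _, hg, rfl⟩, trivial, trivial, rfl, h⟩
      · obtain ⟨n, hn⟩ : ∃ n, y.initialSegment n ≠ x.initialSegment n := by
          by_contra! h
          exact hy (InfinitePath.ext_initialSegment h)
        exact ⟨Sum.inr n, hn⟩)
  -- On the cylinder of the supremum degree, no set of the second kind is met.
  refine ⟨t.toRight.sup id, t.toLeft.map (Function.Embedding.subtype _), ?_, ?_⟩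
  · intro p hp
    obtain ⟨q, -, rfl⟩ := Finset.mem_map.1 hp
    exact q.2
  · intro y hy g hg
    obtain ⟨i, hi, hi'⟩ := Set.mem_iUnion₂.1 (ht hg)
    rcases i with p | n
    · exact ⟨p.1, Finset.mem_map.2 ⟨p, Finset.mem_toLeft.2 hi, rfl⟩, hi'.2.2.1, hi'.2.2.2⟩
    · exact absurd (x.basicNhd_anti (Finset.le_sup (f := id) (Finset.mem_toRight.2 hi)) hy) hi'

/-- The sets of the elements `(y, a - b, y)` with `σᵃ(y) = σᵇ(y)` and `y` in a cylinder set are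
compact. -/
theorem isCompact_isotropy (hΛ : Λ.RowFiniteNoSources) (x : Λ.InfinitePath)
    (N a b : Fin k → ℕ) :
    IsCompact {g : Arrow Λ.InfinitePath | ∃ (y : Λ.InfinitePath) (h : y.shift a = y.shift b),
      y ∈ x.basicNhd N ∧ g = Arrow.mk (groupoidHom a b h)} := by
  let S : Set Λ.InfinitePath := {y | y ∈ x.basicNhd N ∧ y.shift a = y.shift b}
  have hS : IsCompact S := (InfinitePath.isCompact_basicNhd hΛ x N).inter_right
    (isClosed_eq (InfinitePath.continuous_shift a) (InfinitePath.continuous_shift b))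
  have : CompactSpace S := isCompact_iff_compactSpace.1 hS
  let φ : S → Arrow Λ.InfinitePath := fun y => Arrow.mk (groupoidHom a b y.2.2)
  -- A basic set containing `(y, a - b, y)` may use another pair with `m - n = a - b`;
  -- `shift_eq_shift_of_mem_basicNhd` transfers the shift equality to nearby units.
  have hφ : Continuous φ := by
    refine continuous_generateFrom_iff.2 ?_
    rintro _ ⟨U, W, m, n, hU, hW, rfl⟩
    refine isOpen_iff_mem_nhds.2 fun y hy => ?_
    obtain ⟨h1, h2, h3, h4⟩ := hy
    have h : a + n = b + m := by
      ext j
      have h5 : (a j : ℤ) - b j = m j - n j := congrFun h3 j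
      simp only [Pi.add_apply]
      omega
    have hc : ContinuousAt (Subtype.val : S → Λ.InfinitePath) y := continuous_subtype_val.continuousAt
    filter_upwards [hc.preimage_mem_nhds (hU.mem_nhds h1), hc.preimage_mem_nhds (hW.mem_nhds h2),
      hc.preimage_mem_nhds (y.1.basicNhd_mem_nhds (m + a)),
      hc.preimage_mem_nhds (y.1.basicNhd_mem_nhds (n + a))] with y' h5 h6 h7 h8
    exact ⟨h5, h6, h3, InfinitePath.shift_eq_shift_of_mem_basicNhd h h4 h7 h8 y'.2.2⟩
  convert isCompact_range hφ using 1
  ext g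
  constructor
  · rintro ⟨y, h, hy, rfl⟩
    exact ⟨⟨y, hy, h⟩, rfl⟩
  · rintro ⟨y, rfl⟩
    exact ⟨y.1, y.2.2, y.2.1, rfl⟩

/-! ### Open sets of characters -/

/-- This is where the form of condition (ii) originates. For a generating set, `F` comes from the
compactness of `K`, and `ε` from the openness of `W` at the finitely many values of the character on
`F`. -/
theorem exists_torusNhd_of_isOpen {A : Set (IsotropyChar Λ.InfinitePath)} (hA : IsOpen A)
    {x : Λ.InfinitePath} {z : Fin k → Circle} (hx : Λ.toIsotropyChar (x, z) ∈ A) :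
    ∃ ε : ℝ, 0 < ε ∧ ∃ (n : Fin k → ℕ) (F : Finset ((Fin k → ℕ) × (Fin k → ℕ))),
      (∀ p ∈ F, x.shift p.1 = x.shift p.2) ∧
      ∀ y ∈ x.basicNhd n, ∀ w ∈ torusNhd z ε F y, Λ.toIsotropyChar (y, w) ∈ A := by
  classical
  induction hA with
  | basic A hA =>
    obtain ⟨U, K, W, hU, hK, hK', hW, rfl⟩ := hA
    obtain ⟨n, F, hF, hF'⟩ := exists_finset_of_isCompact hK hK' x
    obtain ⟨n', hn'⟩ := InfinitePath.exists_basicNhd_subset hU hx.1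
    have hε : ∀ᶠ ε in 𝓝[>] (0 : ℝ), ∀ p ∈ F,
        Metric.ball (monomial z (degDiff p.1 p.2)) ε ⊆ W := by
      rw [Filter.eventually_all_finset]
      intro p hp
      obtain ⟨-, g, hg, e⟩ := hF p hp
      have h1 : monomial z (degDiff p.1 p.2) ∈ W := by
        rw [← e]; exact hx.2 g hg
      obtain ⟨δ, hδ, hδ'⟩ := Metric.isOpen_iff.1 hW _ h1
      filter_upwards [Ioo_mem_nhdsGT hδ] with ε hε
      exact (Metric.ball_subset_ball hε.2.le).trans hδ'
    obtain ⟨ε, hε, hε'⟩ := (hε.and self_mem_nhdsWithin).exists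
    refine ⟨ε, hε', n ⊔ n', F, fun p hp => (hF p hp).1, fun y hy w hw => ⟨?_, fun g hg => ?_⟩⟩
    · exact hn' (x.basicNhd_anti le_sup_right hy)
    · obtain ⟨p, hp, e, hp'⟩ := hF' y (x.basicNhd_anti le_sup_left hy) g hg
      have hw' : monomial w (degDiff p.1 p.2) ∈ W := hε p hp <| by
        rw [Metric.mem_ball, dist_comm]
        exact lt_of_eq_of_lt (Circle.dist_eq_norm_sub _ _) (hw p hp hp')
      rw [← e] at hw'
      exact hw'
  | univ => exact ⟨1, one_pos, 0, ∅, by simp, fun _ _ _ _ => trivial⟩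
  | inter A B _ _ hA hB =>
    obtain ⟨ε, hε, n, F, hF, h⟩ := hA hx.1
    obtain ⟨ε', hε', n', F', hF', h'⟩ := hB hx.2
    refine ⟨min ε ε', lt_min hε hε', n ⊔ n', F ∪ F', fun p hp => ?_, fun y hy w hw => ⟨?_, ?_⟩⟩
    · exact (Finset.mem_union.1 hp).elim (hF p) (hF' p)
    · exact h y (x.basicNhd_anti le_sup_left hy) w fun p hp e =>
        (hw p (Finset.mem_union_left _ hp) e).trans_le (min_le_left _ _)
    · exact h' y (x.basicNhd_anti le_sup_right hy) w fun p hp e =>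
        (hw p (Finset.mem_union_right _ hp) e).trans_le (min_le_right _ _)
  | sUnion S _ hS =>
    obtain ⟨A, hA, hxA⟩ := hx
    obtain ⟨ε, hε, n, F, hF, h⟩ := hS A hA hxA
    exact ⟨ε, hε, n, F, hF, fun y hy w hw => ⟨A, hA, h y hy w hw⟩⟩

theorem continuous_toIsotropyChar : Continuous Λ.toIsotropyChar := by
  refine continuous_def.2 fun A hA => isOpen_iff_mem_nhds.2 ?_
  rintro ⟨x, z⟩ hx
  obtain ⟨ε, hε, n, F, -, h⟩ := exists_torusNhd_of_isOpen hA hx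
  have h1 : ∀ᶠ w in 𝓝 z, ∀ p ∈ F, dist (monomial w (degDiff p.1 p.2))
      (monomial z (degDiff p.1 p.2)) < ε := by
    rw [Filter.eventually_all_finset]
    exact fun p _ => (continuous_monomial _).continuousAt.eventually (Metric.ball_mem_nhds _ hε)
  filter_upwards [prod_mem_nhds (x.basicNhd_mem_nhds n) h1] with a ha
  refine h a.1 ha.1 a.2 fun p hp _ => ?_
  have h2 := ha.2 p hp
  rw [dist_comm] at h2
  exact lt_of_eq_of_lt (Circle.dist_eq_norm_sub _ _).symm h2

end KGraph

namespace KGraph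

open Filter Topology

variable {k : ℕ} {V : Type u} [Category.{w} V] {Λ : KGraph k V}

theorem self_mem_torusNhd (z : Fin k → Circle) {ε : ℝ} (hε : 0 < ε)
    (F : Finset ((Fin k → ℕ) × (Fin k → ℕ))) (y : Λ.InfinitePath) : z ∈ torusNhd z ε F y := by
  intro p _ _
  simpa using hε

theorem vertex_mem_of_le {D : Set (V × (Fin k → Circle))} (h1 : Λ.SlicesHereditarySaturated D)
    {x : Λ.InfinitePath} {z : Fin k → Circle} {m n : Fin k → ℕ} (hmn : m ≤ n)
    (h : (x.vertex m, z) ∈ D) : (x.vertex n, z) ∈ D :=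
  (h1 z).1 (x.segment m n hmn) h

/-- The paths `x` and `y` eventually visit the same vertices, and by heredity membership in `D`
persists along `x`. -/
theorem exists_vertex_mem_of_shift_eq {D : Set (V × (Fin k → Circle))}
    (h1 : Λ.SlicesHereditarySaturated D) {x y : Λ.InfinitePath} {z : Fin k → Circle}
    {m n : Fin k → ℕ} (h : y.shift m = x.shift n) (hx : ∃ p, (x.vertex p, z) ∈ D) :
    ∃ p, (y.vertex p, z) ∈ D := by
  obtain ⟨p, hp⟩ := hx
  refine ⟨m + p, ?_⟩
  rw [← InfinitePath.vertex_shift, h, InfinitePath.vertex_shift]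
  exact vertex_mem_of_le h1 le_add_self hp

/-! ### From subsets of `Λ⁰ × 𝕋ᵏ` to sets of characters -/

variable (Λ) in
/-- The characters given by the pairs `(x, z)` with `(x(n), z) ∈ D` for some `n`. -/
def charSet (D : Set (V × (Fin k → Circle))) : Set (IsotropyChar Λ.InfinitePath) :=
  Λ.toIsotropyChar '' {a | ∃ n : Fin k → ℕ, (a.1.vertex n, a.2) ∈ D}

/-- The content is that the right side is a union of fibres of `q`: if `z` and `z'` give the same
character at `x`, then `z'` lies in the set `T_y` that (ii) provides for `z` at `y = σⁿ(x)`. -/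
theorem preimage_charSet {D : Set (V × (Fin k → Circle))} (h2 : Λ.LocalCondition D) :
    Λ.toIsotropyChar ⁻¹' Λ.charSet D = {a | ∃ n : Fin k → ℕ, (a.1.vertex n, a.2) ∈ D} := by
  refine Set.Subset.antisymm ?_ (Set.subset_preimage_image _ _)
  rintro ⟨x', z'⟩ ⟨⟨x, z⟩, ⟨n, hn⟩, e⟩
  obtain rfl : x = x' := congrArg Sigma.fst e
  rw [toIsotropyChar_eq_iff] at e
  obtain ⟨ε, hε, N, F, hF, h⟩ := h2 _ _ hn (x.shift n)
    (InfinitePath.mem_cylinder_id.2 (by rw [InfinitePath.vertex_shift, add_zero]))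
  obtain ⟨m, hm⟩ := h (x.shift n) (by
    rw [InfinitePath.cylinder_initialSegment]; exact InfinitePath.mem_basicNhd_self _ _)
  refine ⟨n + m, hm ⟨rfl, fun p hp _ => ?_⟩⟩
  -- A pair for `σⁿ(x)` becomes a pair for `x` after adding `n` to both entries, with the same
  -- difference.
  have h3 := e (p.1 + n) (p.2 + n) (by
    rw [← InfinitePath.shift_shift, ← InfinitePath.shift_shift]; exact hF p hp)
  have h4 : degDiff (p.1 + n) (p.2 + n) = degDiff p.1 p.2 := by
    ext j; simp [degDiff]
  rw [h4] at h3
  change ‖(monomial z (degDiff p.1 p.2) : ℂ) - (monomial z' (degDiff p.1 p.2) : ℂ)‖ < ε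
  rw [h3, sub_self, norm_zero]
  exact hε

theorem isInvariant_charSet {D : Set (V × (Fin k → Circle))}
    (h1 : Λ.SlicesHereditarySaturated D) (h2 : Λ.LocalCondition D) :
    IsotropyChar.IsInvariant (Λ.charSet D) := by
  intro x y g χ hx
  obtain ⟨z, hz⟩ := exists_toIsotropyChar_eq ⟨x, χ⟩
  obtain rfl : (Λ.toIsotropyChar (x, z)).2 = χ := eq_of_heq (Sigma.mk.inj hz).2
  rw [act_toIsotropyChar]
  obtain ⟨m, n, h, -⟩ := exists_eq_groupoidHom g
  have hx' : (x, z) ∈ Λ.toIsotropyChar ⁻¹' Λ.charSet D := hx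
  rw [preimage_charSet h2] at hx'
  exact ⟨(y, z), exists_vertex_mem_of_shift_eq h1 h hx', rfl⟩

theorem isOpen_charSet (hΛ : Λ.RowFiniteNoSources) {D : Set (V × (Fin k → Circle))}
    (h2 : Λ.LocalCondition D) : IsOpen (Λ.charSet D) := by
  refine isOpen_iff_mem_nhds.2 ?_
  rintro _ ⟨⟨x, z⟩, ⟨n, hn⟩, rfl⟩
  obtain ⟨ε, hε, N, F, hF, h⟩ := h2 _ _ hn (x.shift n)
    (InfinitePath.mem_cylinder_id.2 (by rw [InfinitePath.vertex_shift, add_zero]))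
  let K : (Fin k → ℕ) × (Fin k → ℕ) → Set (Arrow Λ.InfinitePath) := fun p =>
    {g | ∃ (y : Λ.InfinitePath) (h : y.shift (p.1 + n) = y.shift (p.2 + n)),
      y ∈ x.basicNhd (n + N) ∧ g = Arrow.mk (groupoidHom (p.1 + n) (p.2 + n) h)}
  let W : (Fin k → ℕ) × (Fin k → ℕ) → Set Circle := fun p =>
    Metric.ball (monomial z (degDiff (p.1 + n) (p.2 + n))) ε
  -- The factor with empty `K` only places the unit in the cylinder. The others keep the character
  -- within `ε` of `z` on the isotropy elements that persist at that unit.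
  let B : Set (IsotropyChar Λ.InfinitePath) :=
    IsotropyChar.basicSet (x.basicNhd (n + N)) ∅ Set.univ ∩
      ⋂ p ∈ F, IsotropyChar.basicSet Set.univ (K p) (W p)
  have hB : IsOpen B := by
    refine IsOpen.inter (TopologicalSpace.isOpen_generateFrom_of_mem ?_)
      (isOpen_biInter_finset fun p _ => TopologicalSpace.isOpen_generateFrom_of_mem ?_)
    · exact ⟨_, _, _, x.isOpen_basicNhd _, isCompact_empty, by simp, isOpen_univ, rfl⟩
    · refine ⟨_, _, _, isOpen_univ, isCompact_isotropy hΛ x (n + N) (p.1 + n) (p.2 + n), ?_,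
        Metric.isOpen_ball, rfl⟩
      rintro _ ⟨y, h, -, rfl⟩
      rfl
  refine mem_of_superset (hB.mem_nhds ⟨⟨x.mem_basicNhd_self _, fun _ h => h.elim⟩, ?_⟩) ?_
  · refine Set.mem_iInter₂.2 fun p hp => ⟨trivial, ?_⟩
    rintro (g : x ⟶ x) ⟨y, h, -, e⟩
    obtain rfl : x = y := congrArg (fun t : Arrow Λ.InfinitePath => t.left) e
    obtain rfl : g = _ := Arrow.mk_injective _ _ e
    exact Metric.mem_ball_self hε
  · intro c hc
    obtain ⟨w, hw⟩ := exists_toIsotropyChar_eq c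
    obtain ⟨y, χ⟩ := c
    obtain rfl : (Λ.toIsotropyChar (y, w)).2 = χ := eq_of_heq (Sigma.mk.inj hw).2
    obtain ⟨⟨hy, -⟩, hc⟩ := hc
    obtain ⟨m, hm⟩ := h (y.shift n) (by
      rw [InfinitePath.cylinder_initialSegment]
      exact InfinitePath.shift_mem_basicNhd hy)
    refine ⟨(y, w), ⟨n + m, hm ⟨rfl, fun p hp hp' => ?_⟩⟩, rfl⟩
    have hp'' : y.shift (p.1 + n) = y.shift (p.2 + n) := by
      rwa [← InfinitePath.shift_shift, ← InfinitePath.shift_shift]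
    have h3 : monomial w (degDiff (p.1 + n) (p.2 + n)) ∈ W p :=
      (Set.mem_iInter₂.1 hc p hp).2 (groupoidHom (p.1 + n) (p.2 + n) hp'') ⟨y, hp'', hy, rfl⟩
    have h4 : degDiff (p.1 + n) (p.2 + n) = degDiff p.1 p.2 := by
      ext j; simp [degDiff]
    have h5 : dist (monomial z (degDiff p.1 p.2)) (monomial w (degDiff p.1 p.2)) < ε := by
      rw [dist_comm, ← h4]; exact h3
    exact lt_of_eq_of_lt (Circle.dist_eq_norm_sub _ _).symm h5

/-! ### From sets of characters to subsets of `Λ⁰ × 𝕋ᵏ` -/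

/-- The pairs `(v, z)` such that `q(x, z) ∈ A` for all infinite paths `x` with range `v`. -/
def vertexSet (A : Set (IsotropyChar Λ.InfinitePath)) : Set (V × (Fin k → Circle)) :=
  {a | ∀ x : Λ.InfinitePath, x.vertex 0 = a.1 → Λ.toIsotropyChar (x, a.2) ∈ A}

/-- An infinite path and any of its shifts lie in one orbit, so membership in `A` passes between `x`
and `f x`, and between `x` and `σⁿ(x)`. -/
theorem slicesHereditarySaturated_vertexSet {A : Set (IsotropyChar Λ.InfinitePath)}
    (hA : IsotropyChar.IsInvariant A) : Λ.SlicesHereditarySaturated (vertexSet A) := by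
  refine fun z => ⟨fun f hf x hx => ?_, fun v n h x hx => ?_⟩
  · obtain ⟨y, hy, hy'⟩ := InfinitePath.exists_concat f x hx
    have h1 : Λ.toIsotropyChar (y, z) ∈ A :=
      hf y (congrArg (fun t : Arrow V => t.right) hy)
    exact hA.toIsotropyChar_mem (m := 0) (n := Λ.deg f.hom)
      (by rw [hy', InfinitePath.shift_zero]) h1
  · have h1 := h (x.initialSegment n) ⟨hx, x.deg_initialSegment n⟩ (x.shift n)
      (by rw [InfinitePath.vertex_shift, add_zero]; rfl)
    exact hA.toIsotropyChar_mem (m := n) (n := 0) (by rw [InfinitePath.shift_zero]) h1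

/-- Every path `y` from `x(n)` is the shift by `n` of `x(0, n) y`, which lies in the cylinder. -/
theorem mem_vertexSet_of_basicNhd {A : Set (IsotropyChar Λ.InfinitePath)}
    (hA : IsotropyChar.IsInvariant A) {x : Λ.InfinitePath} {z : Fin k → Circle} {n : Fin k → ℕ}
    (h : ∀ y ∈ x.basicNhd n, Λ.toIsotropyChar (y, z) ∈ A) : (x.vertex n, z) ∈ vertexSet A := by
  intro y hy
  obtain ⟨u, hu, hu'⟩ := InfinitePath.exists_concat (x.initialSegment n) y hy
  rw [InfinitePath.deg_initialSegment] at hu hu'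
  exact hA.toIsotropyChar_mem (m := 0) (n := n) (by rw [hu', InfinitePath.shift_zero]) (h u hu)

theorem exists_mem_vertexSet_iff {A : Set (IsotropyChar Λ.InfinitePath)} (hA' : IsOpen A)
    (hA : IsotropyChar.IsInvariant A) {x : Λ.InfinitePath} {z : Fin k → Circle} :
    (∃ n, (x.vertex n, z) ∈ vertexSet A) ↔ Λ.toIsotropyChar (x, z) ∈ A := by
  constructor
  · rintro ⟨n, hn⟩
    have h1 := hn (x.shift n) (by rw [InfinitePath.vertex_shift, add_zero])
    exact hA.toIsotropyChar_mem (m := n) (n := 0) (by rw [InfinitePath.shift_zero]) h1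
  · intro h
    obtain ⟨ε, hε, n, F, -, h'⟩ := exists_torusNhd_of_isOpen hA' h
    exact ⟨n, mem_vertexSet_of_basicNhd hA fun y hy => h' y hy z (self_mem_torusNhd z hε F y)⟩

theorem localCondition_vertexSet {A : Set (IsotropyChar Λ.InfinitePath)} (hA' : IsOpen A)
    (hA : IsotropyChar.IsInvariant A) : Λ.LocalCondition (vertexSet A) := by
  intro v z hv x hx
  have hx' := hv x (InfinitePath.mem_cylinder_id.1 hx)
  obtain ⟨ε, hε, n, F, hF, h⟩ := exists_torusNhd_of_isOpen hA' hx'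
  -- Halving `ε` leaves room for non-strict inequalities: the closed, hence compact, set `T` below
  -- contains `T_y` for `ε / 2` and lies in `T_y` for `ε`.
  refine ⟨ε / 2, half_pos hε, n, F, hF, fun y hy => ?_⟩
  rw [InfinitePath.cylinder_initialSegment] at hy
  let T : Set (Fin k → Circle) := ⋂ p ∈ F, ⋂ _ : y.shift p.1 = y.shift p.2,
    {w | dist (monomial z (degDiff p.1 p.2)) (monomial w (degDiff p.1 p.2)) ≤ ε / 2}
  have hT : IsCompact T := by
    refine IsClosed.isCompact (isClosed_biInter fun p _ => isClosed_iInter fun _ => ?_)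
    exact isClosed_le (continuous_const.dist (continuous_monomial _)) continuous_const
  have hTA : {y} ×ˢ T ⊆ Λ.toIsotropyChar ⁻¹' A := by
    rintro ⟨y', w⟩ ⟨rfl, hw⟩
    refine h _ hy w fun p hp e => ?_
    have h1 : dist (monomial z (degDiff p.1 p.2)) (monomial w (degDiff p.1 p.2)) ≤ ε / 2 :=
      Set.mem_iInter.1 (Set.mem_iInter₂.1 hw p hp) e
    exact lt_of_eq_of_lt (Circle.dist_eq_norm_sub _ _).symm (h1.trans_lt (half_lt_self hε))
  -- By the tube lemma one neighbourhood of `y` serves all `w ∈ T`; the degree `m` of a cylinder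
  -- inside it is the required one.
  obtain ⟨U, W, hU, -, hyU, hTW, hUW⟩ := generalized_tube_lemma isCompact_singleton hT
    (hA'.preimage continuous_toIsotropyChar) hTA
  obtain ⟨m, hm⟩ := InfinitePath.exists_basicNhd_subset hU (hyU rfl)
  refine ⟨m, ?_⟩
  rintro ⟨_, w⟩ ⟨rfl, hw⟩
  refine mem_vertexSet_of_basicNhd hA fun u hu => hUW ⟨hm hu, hTW ?_⟩
  refine Set.mem_iInter₂.2 fun p hp => Set.mem_iInter.2 fun e => ?_
  exact le_of_eq_of_le (Circle.dist_eq_norm_sub _ _) (hw p hp e).le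

theorem vertexSet_charSet (hΛ : Λ.RowFiniteNoSources) {D : Set (V × (Fin k → Circle))}
    (h1 : Λ.SlicesHereditarySaturated D) (h2 : Λ.LocalCondition D) :
    vertexSet (Λ.charSet D) = D := by
  have h : ∀ (x : Λ.InfinitePath) (z : Fin k → Circle), Λ.toIsotropyChar (x, z) ∈ Λ.charSet D ↔
      ∃ n, (x.vertex n, z) ∈ D := fun x z => Set.ext_iff.1 (preimage_charSet h2) (x, z)
  ext ⟨v, z⟩
  constructor
  · intro hv
    by_contra hvD
    -- If `(v, z) ∉ D`, a path from `v` avoiding the slice of `D` at `z` gives a character outside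
    -- `charSet D`.
    obtain ⟨x, hx, hx'⟩ := exists_infinitePath_avoiding hΛ (h1 z).1 (h1 z).2 (v := v) hvD
    obtain ⟨n, hn⟩ := (h x z).1 (hv x hx)
    exact hx' n hn
  · rintro hv x rfl
    exact (h x z).2 ⟨0, hv⟩

theorem charSet_vertexSet {A : Set (IsotropyChar Λ.InfinitePath)} (hA' : IsOpen A)
    (hA : IsotropyChar.IsInvariant A) : Λ.charSet (vertexSet A) = A := by
  have h : {a : Λ.InfinitePath × (Fin k → Circle) |
      ∃ n : Fin k → ℕ, (a.1.vertex n, a.2) ∈ vertexSet A} = Λ.toIsotropyChar ⁻¹' A :=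
    Set.ext fun a => exists_mem_vertexSet_iff hA' hA
  rw [charSet, h]
  exact Set.image_preimage_eq _ fun c => ⟨_, (exists_toIsotropyChar_eq c).choose_spec⟩

end KGraph

theorem mainTheorem11 {k : ℕ} {V : Type u} [CategoryTheory.Category.{w} V]
    [Countable (CategoryTheory.Arrow V)] (Λ : KGraph k V) (hΛ : Λ.RowFiniteNoSources) :
    ∃ U : {D : Set (V × (Fin k → Circle)) //
            Λ.SlicesHereditarySaturated D ∧ Λ.LocalCondition D} ≃
          {A : Set (IsotropyChar Λ.InfinitePath) // IsOpen A ∧ IsotropyChar.IsInvariant A},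
      ∀ D, Λ.toIsotropyChar ⁻¹' (U D).1 =
        {a : Λ.InfinitePath × (Fin k → Circle) |
          ∃ n : Fin k → ℕ, (a.1.vertex n, a.2) ∈ D.1} := by
  exact ⟨{
    toFun := fun D => ⟨Λ.charSet D.1, KGraph.isOpen_charSet hΛ D.2.2,
      KGraph.isInvariant_charSet D.2.1 D.2.2⟩
    invFun := fun A => ⟨KGraph.vertexSet A.1,
      KGraph.slicesHereditarySaturated_vertexSet A.2.2,
      KGraph.localCondition_vertexSet A.2.1 A.2.2⟩
    left_inv := fun D => Subtype.ext (KGraph.vertexSet_charSet hΛ D.2.1 D.2.2)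
    right_inv := fun A => Subtype.ext (KGraph.charSet_vertexSet A.2.1 A.2.2) },
    fun D => KGraph.preimage_charSet D.2.2⟩
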